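/- Fix real numbers $\alpha,\beta_L,\beta_R,\delta_L,\delta_R$ and put $\gamma=2\pi-\alpha-\beta_L-\beta_R$. Assume that * $\alpha,\beta_L,\beta_R,\gamma\in(0,\pi)$; * $\alpha<\beta_L+\beta_R$, $\beta_L<\alpha+\beta_R$, $\beta_R<\alpha+\beta_L$; * $0\le\delta_L<\beta_L$, $0\le\delta_R<\beta_R$ and $\gamma+\delta_L+\delta_R<\pi$. In the oriented Euclidean plane let $A\ne B_L$ be points, and let $B_R$ be obtained from $B_L$ by the counterclockwise rotation about $A$ through $\gamma$; the minor arc $B_LB_R$ is the closed arc with center $A$ swept by this rotation. Let $k_L$ (resp. $k_R$) be the ray from $B_L$ (resp. $B_R$) in the direction of $\overrightarrow{AB_L}$ turned clockwise by $\beta_L$ (resp. $\overrightarrow{AB_R}$ turned counterclockwise by $\beta_R$), and let $\ell_L$ (resp. $\ell_R$) be the ray from $B_L$ (resp. $B_R$) in the direction of $\overrightarrow{AB_L}$ turned clockwise by $\delta_L$ (resp. $\overrightarrow{AB_R}$ turned counterclockwise by $\delta_R$). For a point $C\neq A$ let $\gamma_L$ be the counterclockwise angle from ray $AB_L$ to ray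 $AC$, $\gamma_R$ the counterclockwise angle from ray $AC$ to ray $AB_R$, $r=|AC|/|AB_L|$, $$V_1=\sin(\beta_L+\gamma_L)\cos\beta_R+\sin(\beta_R+\gamma_R)\cos\beta_L,\qquad V_2=\sin(\beta_L+\beta_R+\gamma),$$ $$W=\cos(\beta_L+\gamma_L)\cos\beta_R-\cos(\beta_R+\gamma_R)\cos\beta_L .$$ For $X\ne A,C$ let $\rho_L(X)$ be the counterclockwise angle at $C$ from ray $CA$ to ray $CX$, and $\psi_L(X)$ the clockwise angle at $A$ from ray $AC$ to ray $AX$. All these oriented angles are taken in $(-\pi,\pi]$. Then the following hold. 1. The perpendicular to $\ell_L$ through $B_L$ and the perpendicular to $\ell_R$ through $B_R$ meet in exactly one point $C$; the perpendicular to $k_L$ through $B_L$ and the perpendicular to $k_R$ through $B_R$ meet in exactly one point $B'$. The segment $B'C$ meets the minor arc $B_LB_R$ in exactly one point $D_c$ (the canonical dividing point), and $D_c\neq B_L,B_R$. 2. $V_1-rV_2\ne0$, and $D_c$ is the only point $X$ of the minor arc that satisfies the extrusion equation $(V_1-rV_2)\tan\rho_L(X)=W$; it is also the only point $X$ of the minor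 arc with $$\rho_L(X)=\arctan\frac{W}{V_1-rV_2}.$$ Moreover $\psi_L(D_c)=\arcsin\bigl(r\sin\rho_L(D_c)\bigr)-\rho_L(D_c)$. 3. $D_c$ is the only point $X$ of the minor arc other than $B_L,B_R$ with $$\cot\angle B_LCX=\frac{1}{\sin(\beta_L-\delta_L)}\left(\frac{\sin\alpha}{\sin(\beta_R+\gamma/2)}\cdot\frac{\sin(\gamma/2+\delta_R)}{\sin(\gamma+\delta_L+\delta_R)}+\cos(\beta_L-\delta_L)\right),$$ and $\rho_L(D_c)=\frac{\pi}{2}-\bigl(\gamma_L+\delta_L+\angle B_LCD_c\bigr)$. -/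

import Mathlib

open Set

noncomputable section

namespace Origon

/-- The data of a development: the face angles `α, βL, βR` at the vertex `A` of the net, the
deviations `δL, δR` of the prescribed outgoing pleats, the vertex `A` and the lower end `BL` of the
left copy of the ridge.  The plane of the paper is `ℂ` with its standard orientation. -/
structure Development where
  α : ℝ
  βL : ℝ
  βR : ℝ
  δL : ℝ
  δR : ℝ
  A : ℂ
  BL : ℂ

namespace Development

variable (N : Development)

/-- The angle `∠ BL A BR` between the two copies of the ridge: the four angles `α, βL, βR, γ`
around `A` add up to a full turn. -/
def γ : ℝ := 2 * Real.pi - N.α - N.βL - N.βR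

/-- The standing conditions on the angles and on the net. -/
structure Admissible : Prop where
  α_mem : N.α ∈ Ioo 0 Real.pi
  βL_mem : N.βL ∈ Ioo 0 Real.pi
  βR_mem : N.βR ∈ Ioo 0 Real.pi
  γ_mem : N.γ ∈ Ioo 0 Real.pi
  α_lt : N.α < N.βL + N.βR
  βL_lt : N.βL < N.α + N.βR
  βR_lt : N.βR < N.α + N.βL
  δL_nonneg : 0 ≤ N.δL
  δR_nonneg : 0 ≤ N.δR
  δL_lt : N.δL < N.βL
  δR_lt : N.δR < N.βR
  γ_add_lt : N.γ + N.δL + N.δR < Real.pi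
  BL_ne : N.BL ≠ N.A

/-- The vector `v` rotated counterclockwise by the angle `t`. -/
def rot (t : ℝ) (v : ℂ) : ℂ := Complex.exp (t * Complex.I) * v

/-- The lower end of the right copy of the ridge: `AB_R` is `AB_L` turned counterclockwise
by `γ`. -/
def BR : ℂ := N.A + rot N.γ (N.BL - N.A)

/-- Direction of the edge `j_L` from `A` (at angle `βL` clockwise from `AB_L`); the edge `k_L`
starts from `B_L` and is parallel to `j_L`. -/
def kDirL : ℂ := rot (-N.βL) (N.BL - N.A)

/-- Direction of the edge `j_R` from `A` (at angle `βR` counterclockwise from `AB_R`); the edge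
`k_R` starts from `B_R` and is parallel to `j_R`. -/
def kDirR : ℂ := rot N.βR (N.BR - N.A)

/-- Direction of the pleat crease `ℓ_L`, a ray from `B_L`: that of `AB_L` turned clockwise
by `δL`. -/
def ellDirL : ℂ := rot (-N.δL) (N.BL - N.A)

/-- Direction of the pleat crease `ℓ_R`, a ray from `B_R`: that of `AB_R` turned counterclockwise
by `δR`. -/
def ellDirR : ℂ := rot N.δR (N.BR - N.A)

/-- The line through `P` perpendicular to the direction `v`. -/
def perpLine (P v : ℂ) : Set ℂ := {z | inner ℝ v (z - P) = 0}

/-- The minor arc with center `A` from `B_L` counterclockwise to `B_R`, end points included. -/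
def minorArc : Set ℂ := (fun t : ℝ => N.A + rot t (N.BL - N.A)) '' Icc 0 N.γ

/-- The minor arc without its end points. -/
def openMinorArc : Set ℂ := N.minorArc \ {N.BL, N.BR}

attribute [local instance] Complex.finrank_real_complex_fact

/-- The counterclockwise angle at `Q` from the ray `QP` to the ray `QR`, in `(-π, π]`. -/
def ccwAngle (P Q R : ℂ) : ℝ := (Complex.orientation.oangle (P - Q) (R - Q)).toReal

/-- `γ_L`, the counterclockwise angle from `AB_L` to `AC`. -/
def γL (C : ℂ) : ℝ := ccwAngle N.BL N.A C

/-- `γ_R`, the counterclockwise angle from `AC` to `AB_R`. -/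
def γR (C : ℂ) : ℝ := ccwAngle C N.A N.BR

/-- `ρ_L(D)`, the counterclockwise angle at `C` from `CA` to `CD`. -/
def ρL (C D : ℂ) : ℝ := ccwAngle N.A C D

/-- `ψ_L(D)`, the clockwise angle at `A` from `AC` to `AD`. -/
def ψL (C D : ℂ) : ℝ := ccwAngle D N.A C

/-- The ratio `r = |AC| / |AB|`. -/
def r (C : ℂ) : ℝ := dist N.A C / dist N.A N.BL

def V₁ (C : ℂ) : ℝ :=
  Real.sin (N.βL + N.γL C) * Real.cos N.βR + Real.sin (N.βR + N.γR C) * Real.cos N.βL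

def V₂ : ℝ := Real.sin (N.βL + N.βR + N.γ)

def W (C : ℂ) : ℝ :=
  Real.cos (N.βL + N.γL C) * Real.cos N.βR - Real.cos (N.βR + N.γR C) * Real.cos N.βL

/-- The numerical value of `cot ∠ B_L C D_c`, the reciprocal of
`sin (βL - δL) / (K + cos (βL - δL))` with
`K = sin α / sin (βR + γ/2) * (sin (γ/2 + δR) / sin (γ + δL + δR))`.  The reciprocal is used
because `K + cos (βL - δL)` may vanish, namely when the angle is right. -/
def cotBCD : ℝ :=
  (Real.sin N.α / Real.sin (N.βR + N.γ / 2) *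
      (Real.sin (N.γ / 2 + N.δR) / Real.sin (N.γ + N.δL + N.δR)) + Real.cos (N.βL - N.δL)) /
    Real.sin (N.βL - N.δL)

end Development

end Origon

end

noncomputable section

namespace Origon

open Complex ComplexConjugate

/-! Normalise `A = 0`, `B_L = 1`, so that the arc consists of `exp (τ * I)` with `0 ≤ τ ≤ γ`, and
let `c`, `b` be the coordinates of `C`, `B'`. Then `c` lies outside the unit circle, and `b` lies
inside because of the triangle inequalities between `α`, `βL`, `βR` (`normSq_b_lt_one`). The whole
arc is visible from `c`, that is, `⟨c, x⟩ ≥ 1` on it (`one_le_re`).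

The ends of the arc lie strictly on opposite sides of the line `cb`, so this line meets the arc, and
visibility puts the meeting point between `c` and `b` (`exists_mem_arc`). A ray from `c` meets the
visible part of the circle at most once, so a point of the arc is determined by its direction from
`c`.

Both numerical descriptions express this direction. Up to a common positive factor, `V₁ - r V₂` and
`W` are the real and imaginary parts of `conj (-c) * (b - c)` (`norm_mul_V₁_sub_and_norm_mul_W`), so
their quotient is `tan ρ_L(B')`; the cotangent formula solves the triangle `C B_L B'` (`cotBCD_eq`).
The relevant angles stay in a range where tangent or cotangent is injective (`re_pos`, `im_neg`). -/

/-- The signed distance from `1` to `perpFoot γ p q`, along the line through `1` orthogonal to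
`exp (-p * I)`. -/
def perpCoeff (γ p q : ℝ) : ℝ := (Real.cos q - Real.cos (γ + q)) / Real.sin (γ + p + q)

/-- The intersection of the line through `1` orthogonal to `exp (-p * I)` and the line through
`exp (γ * I)` orthogonal to `exp ((γ + q) * I)`. -/
def perpFoot (γ p q : ℝ) : ℂ :=
  ⟨1 + perpCoeff γ p q * Real.sin p, perpCoeff γ p q * Real.cos p⟩

/-! ### Intersection of two perpendiculars -/

lemma cos_sub_cos_add (γ q : ℝ) :
    Real.cos q - Real.cos (γ + q) = 2 * (Real.sin (γ / 2 + q) * Real.sin (γ / 2)) := by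
  have h1 : q = (γ / 2 + q) - γ / 2 := by ring
  have h2 : γ + q = (γ / 2 + q) + γ / 2 := by ring
  rw [h2, Real.cos_add]
  nth_rw 1 [h1]
  rw [Real.cos_sub]; ring

/-- The mirror description: the same point reached from `exp (γ * I)`, with `p` and `q` exchanged.
It lets right-hand estimates copy the left-hand ones. -/
lemma perpFoot_re_right {γ p q : ℝ} (h : Real.sin (γ + p + q) ≠ 0) :
    (perpFoot γ p q).re = Real.cos γ + perpCoeff γ q p * Real.sin (γ + q) := by
  have h' : γ + q + p = γ + p + q := by ring
  simp only [perpFoot, perpCoeff, h']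
  field_simp
  simp only [Real.sin_add, Real.cos_add]
  linear_combination -(Real.sin p * Real.cos q) * Real.sin_sq_add_cos_sq γ

lemma perpFoot_im_right {γ p q : ℝ} (h : Real.sin (γ + p + q) ≠ 0) :
    (perpFoot γ p q).im = Real.sin γ - perpCoeff γ q p * Real.cos (γ + q) := by
  have h' : γ + q + p = γ + p + q := by ring
  simp only [perpFoot, perpCoeff, h']
  field_simp
  simp only [Real.sin_add, Real.cos_add]
  linear_combination -(Real.cos p * Real.cos q) * Real.sin_sq_add_cos_sq γ

/-- Cramer's rule: the linear system has determinant `sin (γ + p + q)`. -/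
lemma eq_perpFoot_iff {γ p q : ℝ} (h : Real.sin (γ + p + q) ≠ 0) (w : ℂ) :
    ((w.re - 1) * Real.cos p - w.im * Real.sin p = 0 ∧
      (w.re - Real.cos γ) * Real.cos (γ + q) + (w.im - Real.sin γ) * Real.sin (γ + q) = 0) ↔
      w = perpFoot γ p q := by
  have hs : Real.sin (γ + p + q) = Real.sin p * Real.cos (γ + q) + Real.cos p * Real.sin (γ + q) := by
    rw [show γ + p + q = p + (γ + q) by ring, Real.sin_add]
  constructor
  · rintro ⟨h1, h2⟩
    have e1 : (perpFoot γ p q).re = 1 + perpCoeff γ p q * Real.sin p := rfl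
    have e2 : (perpFoot γ p q).im = perpCoeff γ p q * Real.cos p := rfl
    have e3 := perpFoot_re_right h
    have e4 := perpFoot_im_right h
    have k1 : (w.re - (perpFoot γ p q).re) * Real.cos p
        - (w.im - (perpFoot γ p q).im) * Real.sin p = 0 := by rw [e1, e2]; linear_combination h1
    have k2 : (w.re - (perpFoot γ p q).re) * Real.cos (γ + q)
        + (w.im - (perpFoot γ p q).im) * Real.sin (γ + q) = 0 := by
      rw [e3, e4]; linear_combination h2
    apply Complex.ext
    · have : (w.re - (perpFoot γ p q).re) * Real.sin (γ + p + q) = 0 := by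
        rw [hs]; linear_combination Real.sin (γ + q) * k1 + Real.sin p * k2
      have := (mul_eq_zero.1 this).resolve_right h
      linarith
    · have : (w.im - (perpFoot γ p q).im) * Real.sin (γ + p + q) = 0 := by
        rw [hs]; linear_combination -Real.cos (γ + q) * k1 + Real.cos p * k2
      have := (mul_eq_zero.1 this).resolve_right h
      linarith
  · rintro rfl
    constructor
    · simp only [perpFoot]; ring
    · rw [perpFoot_re_right h, perpFoot_im_right h]; ring

/-! ### Lines through an outer point and the visible part of the unit circle -/

/-- A ray from a point outside the unit circle meets the part of the circle visible from that point
at most once. -/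
lemma eq_of_visible_of_sub_eq_mul {c x y : ℂ} {s : ℝ} (hc : 1 < normSq c) (hx : normSq x = 1)
    (hy : normSq y = 1) (hxc : 1 ≤ (conj c * x).re) (hyc : 1 ≤ (conj c * y).re)
    (hs : 0 < s) (h : y - c = s * (x - c)) : x = y := by
  have e1 : y.re = c.re + s * (x.re - c.re) := by
    have := congrArg Complex.re h; simp at this; linarith
  have e2 : y.im = c.im + s * (x.im - c.im) := by
    have := congrArg Complex.im h; simp at this; linarith
  simp only [normSq_apply, mul_re, conj_re, conj_im] at *
  rw [e1, e2] at hy hyc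
  set a := x.re - c.re
  set b := x.im - c.im
  have hxr : x.re = c.re + a := by simp [a]
  have hxi : x.im = c.im + b := by simp [b]
  rw [hxr, hxi] at hx hxc
  set k := c.re * a + c.im * b with hk
  set n := a * a + b * b with hn
  set R := c.re * c.re + c.im * c.im with hR
  have h1 : R + 2 * k + n = 1 := by rw [hR, hk, hn]; linarith
  have h2 : R + 2 * (s * k) + s ^ 2 * n = 1 := by rw [hR, hk, hn]; linarith
  have h3 : 1 ≤ R + k := by rw [hR, hk]; linarith
  have h4 : 1 ≤ R + s * k := by rw [hR, hk]; linarith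
  have hs1 : s = 1 := by
    by_contra hne
    have h5 : (s - 1) * (2 * k + (s + 1) * n) = 0 := by linear_combination h2 - h1
    have h6 : 2 * k + (s + 1) * n = 0 := (mul_eq_zero.1 h5).resolve_left (sub_ne_zero.2 hne)
    -- With `u = x - c`, `k + n = ⟨x, u⟩ = 1 - ⟨c, x⟩` and `s * (k + s * n) = 1 - ⟨c, y⟩`, so
    -- visibility makes both nonpositive. By `h6`, `k + n` and `k + s * n` add up to zero, so both
    -- vanish; then `u = 0` and `c` would lie on the circle.
    have h7 : k + n ≤ 0 := by linarith
    have h8 : s * (k + s * n) ≤ 0 := by nlinarith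
    have h9 : k + s * n ≤ 0 := by
      by_contra hcon
      push Not at hcon
      have := mul_pos hs hcon
      linarith
    have hn0 : 0 ≤ n := by rw [hn]; nlinarith [sq_nonneg a, sq_nonneg b]
    have hk1 : k + n = 0 := by linarith
    have hk2 : (s - 1) * n = 0 := by linear_combination h6 - 2 * hk1
    have hn1 : n = 0 := (mul_eq_zero.1 hk2).resolve_left (sub_ne_zero.2 hne)
    rw [hn1] at hk1 h1
    linarith
  apply Complex.ext
  · rw [e1, hs1, hxr]; ring
  · rw [e2, hs1, hxi]; ring

/-- If a line through a point `c` outside and a point `b` inside the unit circle meets the part of the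
circle visible from `c`, then it does so between `c` and `b`. -/
lemma mem_Ioo_of_visible {c b x : ℂ} {s : ℝ} (hc : 1 < normSq c) (hb : normSq b < 1)
    (hx : normSq x = 1) (hxc : 1 ≤ (conj c * x).re) (h : x - c = s * (b - c)) : s ∈ Ioo 0 1 := by
  have e1 : x.re = c.re + s * (b.re - c.re) := by
    have := congrArg Complex.re h; simp at this; linarith
  have e2 : x.im = c.im + s * (b.im - c.im) := by
    have := congrArg Complex.im h; simp at this; linarith
  simp only [normSq_apply, mul_re, conj_re, conj_im] at *
  rw [e1, e2] at hx hxc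
  set a := b.re - c.re
  set d := b.im - c.im
  have hbr : b.re = c.re + a := by simp [a]
  have hbi : b.im = c.im + d := by simp [d]
  rw [hbr, hbi] at hb
  set k := c.re * a + c.im * d with hk
  set n := a * a + d * d with hn
  set R := c.re * c.re + c.im * c.im with hR
  have h1 : R + 2 * k + n < 1 := by rw [hR, hk, hn]; linarith
  have h2 : R + 2 * (s * k) + s ^ 2 * n = 1 := by rw [hR, hk, hn]; linarith
  have h4 : 1 ≤ R + s * k := by rw [hR, hk]; linarith
  have hn0 : 0 ≤ n := by rw [hn]; nlinarith [sq_nonneg a, sq_nonneg d]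
  have hk0 : k < 0 := by linarith
  have h5 : s * k + s ^ 2 * n ≤ 0 := by linarith
  have hs0 : 0 < s := by
    by_contra hcon
    push Not at hcon
    have : 0 ≤ s * k := mul_nonneg_of_nonpos_of_nonpos hcon hk0.le
    have : 0 ≤ s ^ 2 * n := by positivity
    linarith
  refine ⟨hs0, ?_⟩
  by_contra hcon
  push Not at hcon
  -- This is half the derivative at `s` of the convex function `t ↦ |c + t (b - c)|²`, whose value
  -- at `s` is `1`. If `s ≥ 1`, its value at `1` would be at least `1`, against `|b| < 1`.
  have h6 : k + s * n ≤ 0 := by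
    by_contra h'
    push Not at h'
    have := mul_pos hs0 h'
    nlinarith
  nlinarith [mul_nonneg (sub_nonneg.2 hcon) (mul_nonneg (sub_nonneg.2 hcon) hn0), mul_nonneg (sub_nonneg.2 hcon) (neg_nonneg.2 h6)]

lemma exists_eq_ofReal_mul {u w : ℂ} (hu : u ≠ 0) (h : (conj u * w).im = 0) :
    ∃ s : ℝ, w = s * u := by
  refine ⟨(conj u * w).re / normSq u, ?_⟩
  have hn : (normSq u : ℂ) ≠ 0 := by exact_mod_cast (normSq_pos.2 hu).ne'
  have h1 : ((conj u * w).re : ℂ) = conj u * w := Complex.ext rfl (by simpa using h.symm)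
  push_cast
  rw [h1]
  field_simp
  rw [normSq_eq_conj_mul_self]; ring

/-- In the right half-plane the slope determines the ray from the origin. -/
lemma exists_pos_eq_mul {z w : ℂ} (hz : 0 < z.re) (hw : 0 < w.re)
    (h : z.im / z.re = w.im / w.re) : ∃ s : ℝ, 0 < s ∧ w = s * z := by
  refine ⟨w.re / z.re, div_pos hw hz, ?_⟩
  rw [div_eq_div_iff hz.ne' hw.ne'] at h
  apply Complex.ext
  · rw [re_ofReal_mul]; field_simp
  · rw [im_ofReal_mul]; field_simp; linarith

lemma arg_eq_arctan {z : ℂ} (hz : 0 < z.re) : arg z = Real.arctan (z.im / z.re) := by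
  have := abs_lt.1 (abs_arg_lt_pi_div_two_iff.2 (Or.inl hz))
  rw [← tan_arg, Real.arctan_tan this.1 this.2]

lemma normSq_exp_ofReal_mul_I (t : ℝ) : normSq (exp (t * I)) = 1 := by
  rw [normSq_eq_norm_sq, norm_exp_ofReal_mul_I]; norm_num

/-- If the two ends of the arc from `1` to `exp (γ * I)` lie beyond or on the polar line of `c`, then so
does the whole arc. -/
lemma one_le_re_conj_mul_exp {γ τ : ℝ} {c : ℂ} (hγ : γ ∈ Ioo 0 Real.pi) (hτ : τ ∈ Icc 0 γ)
    (h₀ : 1 ≤ c.re) (h₁ : 1 ≤ c.re * Real.cos γ + c.im * Real.sin γ) :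
    1 ≤ (conj c * exp (τ * I)).re := by
  have hs := Real.sin_pos_of_mem_Ioo hγ
  have s1 : 0 ≤ Real.sin τ := Real.sin_nonneg_of_nonneg_of_le_pi hτ.1 (by linarith [hτ.2, hγ.2])
  have s2 : 0 ≤ Real.sin (γ - τ) :=
    Real.sin_nonneg_of_nonneg_of_le_pi (by linarith [hτ.2]) (by linarith [hτ.1, hγ.2])
  have e : (conj c * exp (τ * I)).re = c.re * Real.cos τ + c.im * Real.sin τ := by
    simp [mul_re, exp_ofReal_mul_I_re, exp_ofReal_mul_I_im]
  rw [e]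
  have hsplit : Real.sin γ = Real.sin (γ - τ) * Real.cos τ + Real.cos (γ - τ) * Real.sin τ := by
    rw [← Real.sin_add]; congr 1; ring
  -- `exp (τ * I)` is a combination of the two ends with weights `sin (γ - τ) / sin γ` and `sin τ /
  -- sin γ`, which are nonnegative with sum at least `1` by `h4`.
  have h3 : Real.sin γ * (c.re * Real.cos τ + c.im * Real.sin τ) =
      Real.sin (γ - τ) * c.re + Real.sin τ * (c.re * Real.cos γ + c.im * Real.sin γ) := by
    rw [Real.sin_sub]; ring
  have h4 : Real.sin γ ≤ Real.sin (γ - τ) + Real.sin τ := by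
    rw [hsplit]
    nlinarith [Real.cos_le_one τ, Real.cos_le_one (γ - τ)]
  by_contra hcon
  push Not at hcon
  nlinarith [mul_lt_mul_of_pos_left hcon hs]

namespace Development

variable {N : Development}

/-! ### Position of `C` and `B'` relative to the circle and the arc -/

/-- The point `C` in the coordinate in which `A` is `0` and `B_L` is `1`. -/
def c (N : Development) : ℂ := perpFoot N.γ N.δL N.δR

/-- The point `B'` in the coordinate in which `A` is `0` and `B_L` is `1`. -/
def b (N : Development) : ℂ := perpFoot N.γ N.βL N.βR

lemma sin_add_β (N : Development) : Real.sin (N.γ + N.βL + N.βR) = -Real.sin N.α := by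
  rw [show N.γ + N.βL + N.βR = 2 * Real.pi - N.α by unfold γ; ring, Real.sin_two_pi_sub]

lemma cos_γ_add_βR (N : Development) : Real.cos (N.γ + N.βR) = Real.cos (N.α + N.βL) := by
  rw [show N.γ + N.βR = 2 * Real.pi - (N.α + N.βL) by unfold γ; ring, Real.cos_two_pi_sub]

namespace Admissible

variable (hN : N.Admissible)
include hN

lemma sin_α_pos : 0 < Real.sin N.α := Real.sin_pos_of_mem_Ioo hN.α_mem

lemma sin_add_δ_pos : 0 < Real.sin (N.γ + N.δL + N.δR) :=
  Real.sin_pos_of_pos_of_lt_pi (by linarith [hN.γ_mem.1, hN.δL_nonneg, hN.δR_nonneg]) hN.γ_add_lt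

lemma sin_add_β_ne : Real.sin (N.γ + N.βL + N.βR) ≠ 0 := by
  rw [sin_add_β]; exact neg_ne_zero.2 hN.sin_α_pos.ne'

lemma coeff_δ_pos : 0 < perpCoeff N.γ N.δL N.δR :=
  div_pos (sub_pos.2 (Real.cos_lt_cos_of_nonneg_of_le_pi hN.δR_nonneg
    (by linarith [hN.γ_add_lt, hN.δL_nonneg]) (by linarith [hN.γ_mem.1]))) hN.sin_add_δ_pos

lemma coeff_δ_pos' : 0 < perpCoeff N.γ N.δR N.δL := by
  refine div_pos (sub_pos.2 (Real.cos_lt_cos_of_nonneg_of_le_pi hN.δL_nonneg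
    (by linarith [hN.γ_add_lt, hN.δR_nonneg]) (by linarith [hN.γ_mem.1]))) ?_
  rw [add_right_comm]; exact hN.sin_add_δ_pos

lemma half_γ_mem : N.γ / 2 ∈ Ioo 0 Real.pi := by
  have := hN.γ_mem
  constructor <;> linarith [this.1, this.2]

/-- The angle equals `π - (α + βL - βR) / 2`, so it is below `π` by a triangle inequality. -/
lemma sin_half_add_βR_pos : 0 < Real.sin (N.γ / 2 + N.βR) := by
  have h1 := hN.βR_lt
  have h2 := hN.βL_lt
  have h3 := hN.βR_mem.1
  have h4 := hN.γ_mem.1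
  have h5 := hN.half_γ_mem.1
  apply Real.sin_pos_of_pos_of_lt_pi
  · linarith
  · unfold γ; linarith

lemma sin_half_add_βL_pos : 0 < Real.sin (N.γ / 2 + N.βL) := by
  have h2 := hN.βL_lt
  have h3 := hN.βL_mem.1
  have h5 := hN.half_γ_mem.1
  apply Real.sin_pos_of_pos_of_lt_pi
  · linarith
  · unfold γ; linarith

lemma coeff_β_neg : perpCoeff N.γ N.βL N.βR < 0 := by
  unfold perpCoeff
  rw [sin_add_β, cos_sub_cos_add]
  have := hN.sin_half_add_βR_pos
  have := Real.sin_pos_of_mem_Ioo hN.half_γ_mem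
  exact div_neg_of_pos_of_neg (by positivity) (neg_neg_of_pos hN.sin_α_pos)

lemma coeff_β_neg' : perpCoeff N.γ N.βR N.βL < 0 := by
  unfold perpCoeff
  rw [add_right_comm, sin_add_β, cos_sub_cos_add]
  have := hN.sin_half_add_βL_pos
  have := Real.sin_pos_of_mem_Ioo hN.half_γ_mem
  exact div_neg_of_pos_of_neg (by positivity) (neg_neg_of_pos hN.sin_α_pos)

lemma sin_δL_nonneg : 0 ≤ Real.sin N.δL :=
  Real.sin_nonneg_of_nonneg_of_le_pi hN.δL_nonneg (hN.δL_lt.trans hN.βL_mem.2).le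

lemma sin_δR_nonneg : 0 ≤ Real.sin N.δR :=
  Real.sin_nonneg_of_nonneg_of_le_pi hN.δR_nonneg (hN.δR_lt.trans hN.βR_mem.2).le

lemma one_lt_normSq_c : 1 < normSq N.c := by
  have hT := hN.coeff_δ_pos
  have hs := hN.sin_δL_nonneg
  rw [c, perpFoot, normSq_mk]
  nlinarith [Real.sin_sq_add_cos_sq N.δL, mul_nonneg hT.le hs, mul_pos hT hT]

/-- With `T` the negative coefficient, `|b|² = 1 + T (T + 2 sin βL)`. The bound `T > -2 sin βL`
amounts to `cos βR < cos (α - βL)`, that is, to `|α - βL| < βR`. -/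
lemma normSq_b_lt_one : normSq N.b < 1 := by
  have hT := hN.coeff_β_neg
  have hα := hN.sin_α_pos
  have hcos : Real.cos N.βR < Real.cos (N.α - N.βL) := by
    rw [← Real.cos_abs (N.α - N.βL)]
    refine Real.cos_lt_cos_of_nonneg_of_le_pi (abs_nonneg _) hN.βR_mem.2.le ?_
    rw [abs_lt]
    constructor <;> linarith [hN.βL_lt, hN.α_lt]
  have h : 0 < perpCoeff N.γ N.βL N.βR + 2 * Real.sin N.βL := by
    rw [perpCoeff, sin_add_β, cos_γ_add_βR, div_neg, neg_add_eq_sub, sub_pos, div_lt_iff₀ hα]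
    rw [Real.cos_sub] at hcos
    rw [Real.cos_add]
    linarith
  have hprod := mul_neg_of_neg_of_pos hT h
  have e : normSq N.b = 1 + perpCoeff N.γ N.βL N.βR * (perpCoeff N.γ N.βL N.βR + 2 * Real.sin N.βL) := by
    rw [b, perpFoot, normSq_mk]
    linear_combination (perpCoeff N.γ N.βL N.βR) ^ 2 * Real.sin_sq_add_cos_sq N.βL
  linarith

lemma one_le_re {τ : ℝ} (hτ : τ ∈ Icc 0 N.γ) : 1 ≤ (conj N.c * exp (τ * I)).re := by
  apply one_le_re_conj_mul_exp hN.γ_mem hτ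
  · simp only [c, perpFoot]
    linarith [mul_nonneg hN.coeff_δ_pos.le hN.sin_δL_nonneg]
  · rw [c, perpFoot_re_right hN.sin_add_δ_pos.ne', perpFoot_im_right hN.sin_add_δ_pos.ne']
    have h : Real.sin N.δR = Real.sin (N.γ + N.δR) * Real.cos N.γ
        - Real.cos (N.γ + N.δR) * Real.sin N.γ := by rw [← Real.sin_sub]; congr 1; ring
    have := mul_nonneg hN.coeff_δ_pos'.le hN.sin_δR_nonneg
    rw [h] at this
    linarith [Real.sin_sq_add_cos_sq N.γ]

lemma eq_of_sub_eq_mul {σ τ s : ℝ} (hσ : σ ∈ Icc 0 N.γ) (hτ : τ ∈ Icc 0 N.γ) (hs : 0 < s)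
    (h : exp (τ * I) - N.c = s * (exp (σ * I) - N.c)) : exp (τ * I) = exp (σ * I) :=
  (eq_of_visible_of_sub_eq_mul hN.one_lt_normSq_c (normSq_exp_ofReal_mul_I _)
    (normSq_exp_ofReal_mul_I _) (hN.one_le_re hσ) (hN.one_le_re hτ) hs h).symm

lemma b_sub_c_ne : N.b - N.c ≠ 0 := by
  intro h
  have := hN.one_lt_normSq_c
  have := hN.normSq_b_lt_one
  rw [sub_eq_zero.1 h] at this
  linarith

lemma exists_mem_arc : ∃ τ ∈ Ioo 0 N.γ, ∃ s ∈ Ioo (0 : ℝ) 1,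
    exp (τ * I) - N.c = s * (N.b - N.c) := by
  -- The cross product of `b - c` and `exp (τ * I) - c`; at each end it factors into the two signed
  -- distances from that end and the sine of the angle between the perpendiculars.
  let f : ℝ → ℝ := fun τ => (conj (N.b - N.c) * (exp (τ * I) - N.c)).im
  have hf : ContinuousOn f (Icc 0 N.γ) := by
    apply Continuous.continuousOn
    fun_prop
  have h0 : 0 < f 0 := by
    have hs : 0 < Real.sin (N.βL - N.δL) := Real.sin_pos_of_pos_of_lt_pi (by linarith [hN.δL_lt])
      (by linarith [hN.βL_mem.2, hN.δL_nonneg])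
    have e : f 0 = -perpCoeff N.γ N.βL N.βR * (perpCoeff N.γ N.δL N.δR *
        Real.sin (N.βL - N.δL)) := by
      simp only [f, b, c, perpFoot, mul_im, sub_re, sub_im, conj_re, conj_im, ofReal_zero, zero_mul,
        exp_zero, one_re, one_im, Real.sin_sub]
      ring
    rw [e]
    exact mul_pos (neg_pos.2 hN.coeff_β_neg) (mul_pos hN.coeff_δ_pos hs)
  have h1 : f N.γ < 0 := by
    have hs : 0 < Real.sin (N.βR - N.δR) := Real.sin_pos_of_pos_of_lt_pi (by linarith [hN.δR_lt])
      (by linarith [hN.βR_mem.2, hN.δR_nonneg])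
    have e : f N.γ = perpCoeff N.γ N.βR N.βL * (perpCoeff N.γ N.δR N.δL *
        Real.sin (N.βR - N.δR)) := by
      rw [show N.βR - N.δR = (N.γ + N.βR) - (N.γ + N.δR) by ring]
      simp only [f, b, c, mul_im, sub_re, sub_im, conj_re, conj_im, exp_ofReal_mul_I_re,
        exp_ofReal_mul_I_im, Real.sin_sub, perpFoot_re_right hN.sin_add_δ_pos.ne',
        perpFoot_im_right hN.sin_add_δ_pos.ne', perpFoot_re_right hN.sin_add_β_ne,
        perpFoot_im_right hN.sin_add_β_ne]
      ring
    rw [e]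
    exact mul_neg_of_neg_of_pos hN.coeff_β_neg' (mul_pos hN.coeff_δ_pos' hs)
  obtain ⟨τ, hτ, hfτ⟩ := intermediate_value_Ioo' hN.γ_mem.1.le hf ⟨h1, h0⟩
  obtain ⟨s, hs⟩ := exists_eq_ofReal_mul hN.b_sub_c_ne hfτ
  exact ⟨τ, hτ, s, mem_Ioo_of_visible hN.one_lt_normSq_c hN.normSq_b_lt_one
    (normSq_exp_ofReal_mul_I _) (hN.one_le_re (Ioo_subset_Icc_self hτ)) hs, hs⟩

/-- Twice this inner product is `|x - c|² + |c|² - |x|²`. Hence `ρ_L` lies in `(-π/2, π/2)` on the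
closed disc, where it is an arctangent. -/
lemma re_pos {x : ℂ} (hx : normSq x ≤ 1) : 0 < (conj (-N.c) * (x - N.c)).re := by
  have h := hN.one_lt_normSq_c
  rw [normSq_apply] at hx h
  simp only [mul_re, sub_re, sub_im, conj_re, conj_im, neg_re, neg_im]
  nlinarith [sq_nonneg (x.re - N.c.re), sq_nonneg (x.im - N.c.im)]

/-- Seen from `C`, the arc lies strictly clockwise of `B_L`, since `δL + τ` stays below `π`. -/
lemma im_neg {τ : ℝ} (hτ : τ ∈ Ioc 0 N.γ) : (conj (1 - N.c) * (exp (τ * I) - N.c)).im < 0 := by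
  have e : (conj (1 - N.c) * (exp (τ * I) - N.c)).im =
      perpCoeff N.γ N.δL N.δR * (Real.cos (N.δL + τ) - Real.cos N.δL) := by
    simp only [c, perpFoot, mul_im, sub_re, sub_im, conj_re, conj_im, exp_ofReal_mul_I_re,
      exp_ofReal_mul_I_im, one_re, one_im, Real.cos_add]
    ring
  rw [e]
  refine mul_neg_of_pos_of_neg hN.coeff_δ_pos (sub_neg.2 ?_)
  exact Real.cos_lt_cos_of_nonneg_of_le_pi hN.δL_nonneg
    (by linarith [hτ.2, hN.γ_add_lt, hN.δR_nonneg]) (by linarith [hτ.1])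

end Admissible

-- Transfer between the plane and the normalised coordinate

attribute [local instance] Complex.finrank_real_complex_fact

/-- The point with coordinate `x` when `A` is `0` and `B_L` is `1`. -/
def point (N : Development) (x : ℂ) : ℂ := N.A + (N.BL - N.A) * x

lemma point_zero (N : Development) : N.point 0 = N.A := by simp [point]

lemma point_one (N : Development) : N.point 1 = N.BL := by simp [point]

lemma point_sub (N : Development) (x y : ℂ) : N.point x - N.point y = (N.BL - N.A) * (x - y) := by
  simp only [point]; ring

lemma point_exp_γ (N : Development) : N.point (exp (N.γ * I)) = N.BR := by
  simp only [point, BR, rot]; ring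

lemma minorArc_eq (N : Development) :
    N.minorArc = (fun t : ℝ => N.point (exp (t * I))) '' Icc 0 N.γ := by
  simp only [minorArc, point, rot, mul_comm]

lemma ccwAngle_point {x y z : ℂ} (h : N.BL ≠ N.A) :
    ccwAngle (N.point x) (N.point y) (N.point z) = arg (conj (x - y) * (z - y)) := by
  have hv : 0 < normSq (N.BL - N.A) := normSq_pos.2 (sub_ne_zero.2 h)
  rw [ccwAngle, Complex.oangle, arg_coe_angle_toReal_eq_arg, point_sub, point_sub,
    ← arg_real_mul (conj (x - y) * (z - y)) hv, normSq_eq_conj_mul_self]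
  congr 1
  simp only [map_mul]
  ring

lemma mem_perpLine_point {x y w : ℂ} (h : N.BL ≠ N.A) :
    N.point x ∈ perpLine (N.point y) ((N.BL - N.A) * w) ↔ (conj w * (x - y)).re = 0 := by
  have hv : normSq (N.BL - N.A) ≠ 0 := (normSq_pos.2 (sub_ne_zero.2 h)).ne'
  rw [perpLine, mem_ofPred_eq, Complex.inner, point_sub]
  have e : (N.BL - N.A) * (x - y) * conj ((N.BL - N.A) * w)
      = (normSq (N.BL - N.A) : ℂ) * (conj w * (x - y)) := by
    rw [normSq_eq_conj_mul_self, map_mul]; ring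
  rw [e, re_ofReal_mul, mul_eq_zero, or_iff_right hv]

lemma exists_eq_point (h : N.BL ≠ N.A) (X : ℂ) : ∃ x, X = N.point x := by
  refine ⟨(X - N.A) / (N.BL - N.A), ?_⟩
  rw [point, mul_div_cancel₀ _ (sub_ne_zero.2 h)]; ring

lemma point_injective (h : N.BL ≠ N.A) : Function.Injective N.point := by
  intro x y hxy
  have := N.point_sub x y
  rw [hxy, sub_self, eq_comm, mul_eq_zero, or_iff_right (sub_ne_zero.2 h)] at this
  exact sub_eq_zero.1 this

lemma perpLine_inter_perpLine (h : N.BL ≠ N.A) {p q : ℝ} (hs : Real.sin (N.γ + p + q) ≠ 0) :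
    perpLine N.BL (rot (-p) (N.BL - N.A)) ∩ perpLine N.BR (rot q (N.BR - N.A)) =
      {N.point (perpFoot N.γ p q)} := by
  have e1 : rot (-p) (N.BL - N.A) = (N.BL - N.A) * exp ((-p : ℝ) * I) := by
    rw [rot, mul_comm]
  have e2 : rot q (N.BR - N.A) = (N.BL - N.A) * exp ((N.γ + q : ℝ) * I) := by
    simp only [BR, rot, add_sub_cancel_left]
    push_cast
    rw [add_mul, Complex.exp_add]; ring
  ext X
  obtain ⟨x, rfl⟩ := exists_eq_point h X
  rw [mem_inter_iff, e1, e2]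
  nth_rw 1 [← N.point_one]
  rw [← N.point_exp_γ, mem_perpLine_point h, mem_perpLine_point h, mem_singleton_iff,
    (point_injective h).eq_iff, ← eq_perpFoot_iff hs]
  simp only [mul_re, conj_re, conj_im, sub_re, sub_im, one_re, one_im, exp_ofReal_mul_I_re,
    exp_ofReal_mul_I_im, Real.cos_neg, Real.sin_neg]
  apply and_congr <;> constructor <;> intro hh <;> linarith

lemma r_point (h : N.BL ≠ N.A) (x : ℂ) : N.r (N.point x) = ‖x‖ := by
  have hv : ‖N.BL - N.A‖ ≠ 0 := norm_ne_zero_iff.2 (sub_ne_zero.2 h)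
  have e1 := N.point_sub x 0
  rw [point_zero, sub_zero] at e1
  rw [r, dist_comm, dist_comm N.A, dist_eq_norm, dist_eq_norm, e1, norm_mul, mul_div_cancel_left₀ _ hv]

lemma γL_point (h : N.BL ≠ N.A) (x : ℂ) : N.γL (N.point x) = arg x := by
  have := ccwAngle_point (x := 1) (y := 0) (z := x) h
  rw [point_one, point_zero] at this
  rw [γL, this]; simp

lemma γR_point (h : N.BL ≠ N.A) (x : ℂ) : N.γR (N.point x) = arg (conj x * exp (N.γ * I)) := by
  have := ccwAngle_point (x := x) (y := 0) (z := exp (N.γ * I)) h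
  rw [point_exp_γ, point_zero] at this
  rw [γR, this]; simp

lemma ρL_point (h : N.BL ≠ N.A) (x y : ℂ) :
    N.ρL (N.point x) (N.point y) = arg (conj (-x) * (y - x)) := by
  have := ccwAngle_point (x := 0) (y := x) (z := y) h
  rw [point_zero] at this
  rw [ρL, this, zero_sub]

lemma ψL_point (h : N.BL ≠ N.A) (x y : ℂ) :
    N.ψL (N.point x) (N.point y) = arg (conj y * x) := by
  have := ccwAngle_point (x := y) (y := 0) (z := x) h
  rw [point_zero] at this
  rw [ψL, this]; simp

lemma angle_point (h : N.BL ≠ N.A) {x y z : ℂ} (hxy : x ≠ y) (hzy : z ≠ y) :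
    EuclideanGeometry.angle (N.point x) (N.point y) (N.point z) =
      |arg (conj (x - y) * (z - y))| := by
  have hv := sub_ne_zero.2 h
  have hx := sub_ne_zero.2 hxy
  have hz := sub_ne_zero.2 hzy
  have hn : 0 < (normSq (x - y))⁻¹ := inv_pos.2 (normSq_pos.2 hx)
  rw [EuclideanGeometry.angle, vsub_eq_sub, vsub_eq_sub, point_sub, point_sub,
    InnerProductGeometry.angle_comm,
    Complex.angle_eq_abs_arg (mul_ne_zero hv hz) (mul_ne_zero hv hx),
    mul_div_mul_left _ _ hv, ← arg_real_mul (conj (x - y) * (z - y)) hn, div_eq_mul_inv,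
    Complex.inv_def]
  congr 2
  ring

/-- Multiplying by `‖x‖` turns the sines and cosines of `γ_L`, `γ_R` into coordinates of `x` and of
`conj x * exp (γ * I)`; what remains is a polynomial identity. The common factor is `sin α`. -/
lemma norm_mul_V₁_sub_and_norm_mul_W (h : N.BL ≠ N.A) (x : ℂ)
    (hs : Real.sin (N.γ + N.βL + N.βR) ≠ 0) :
    ‖x‖ * (N.V₁ (N.point x) - N.r (N.point x) * N.V₂) =
        -Real.sin (N.γ + N.βL + N.βR) * (conj (-x) * (N.b - x)).re ∧
      ‖x‖ * N.W (N.point x) =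
        -Real.sin (N.γ + N.βL + N.βR) * (conj (-x) * (N.b - x)).im := by
  have hny : ‖conj x * exp (N.γ * I)‖ = ‖x‖ := by
    rw [norm_mul, norm_exp_ofReal_mul_I, norm_conj, mul_one]
  have hsq : ‖x‖ * ‖x‖ = x.re * x.re + x.im * x.im := by
    rw [← normSq_apply, normSq_eq_norm_sq, sq]
  have hT : perpCoeff N.γ N.βL N.βR * Real.sin (N.γ + N.βL + N.βR) =
      Real.cos N.βR - Real.cos (N.γ + N.βR) := div_mul_cancel₀ _ hs
  have hS : N.γ + N.βL + N.βR = N.βL + (N.γ + N.βR) := by ring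
  have hS' : N.βL + N.βR + N.γ = N.βL + (N.γ + N.βR) := by ring
  have c1 := norm_mul_cos_arg x
  have c2 := norm_mul_sin_arg x
  have c3 := norm_mul_cos_arg (conj x * exp (N.γ * I))
  have c4 := norm_mul_sin_arg (conj x * exp (N.γ * I))
  rw [hny] at c3 c4
  simp only [mul_re, mul_im, conj_re, conj_im, exp_ofReal_mul_I_re, exp_ofReal_mul_I_im] at c3 c4
  rw [hS] at hT
  rw [V₁, V₂, W, r_point h, γL_point h, γR_point h, hS, hS']
  simp only [b, perpFoot, mul_re, mul_im, conj_re, conj_im, sub_re, sub_im, neg_re, neg_im]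
  simp only [Real.sin_add, Real.cos_add] at hT ⊢
  constructor
  · linear_combination Real.sin N.βL * Real.cos N.βR * c1 + Real.cos N.βL * Real.cos N.βR * c2 +
      Real.sin N.βR * Real.cos N.βL * c3 + Real.cos N.βR * Real.cos N.βL * c4 -
      (x.re * Real.sin N.βL + x.im * Real.cos N.βL) * hT -
      (Real.sin N.βL * (Real.cos N.γ * Real.cos N.βR - Real.sin N.γ * Real.sin N.βR) +
        Real.cos N.βL * (Real.sin N.γ * Real.cos N.βR + Real.cos N.γ * Real.sin N.βR)) * hsq
  · linear_combination Real.cos N.βL * Real.cos N.βR * c1 - Real.sin N.βL * Real.cos N.βR * c2 -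
      Real.cos N.βR * Real.cos N.βL * c3 + Real.sin N.βR * Real.cos N.βL * c4 +
      (x.im * Real.sin N.βL - x.re * Real.cos N.βL) * hT

/-! ### The angles at `C` and `A` -/

namespace Admissible

variable (hN : N.Admissible)
include hN

lemma c_ne_zero : N.c ≠ 0 := by
  intro h
  have := hN.one_lt_normSq_c
  rw [h, map_zero] at this
  linarith

lemma exp_sub_c_ne (τ : ℝ) : exp (τ * I) - N.c ≠ 0 := by
  intro h
  have := hN.re_pos (normSq_exp_ofReal_mul_I τ).le
  rw [h] at this
  simp at this

lemma re_b_pos : 0 < (conj (-N.c) * (N.b - N.c)).re := hN.re_pos hN.normSq_b_lt_one.le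

lemma V₁_sub_pos : 0 < N.V₁ (N.point N.c) - N.r (N.point N.c) * N.V₂ := by
  have h := (norm_mul_V₁_sub_and_norm_mul_W hN.BL_ne N.c hN.sin_add_β_ne).1
  rw [sin_add_β, neg_neg] at h
  have := mul_pos hN.sin_α_pos hN.re_b_pos
  rw [← h] at this
  exact pos_of_mul_pos_right this (norm_nonneg _)

lemma W_div : N.W (N.point N.c) / (N.V₁ (N.point N.c) - N.r (N.point N.c) * N.V₂) =
    (conj (-N.c) * (N.b - N.c)).im / (conj (-N.c) * (N.b - N.c)).re := by
  have h := norm_mul_V₁_sub_and_norm_mul_W hN.BL_ne N.c hN.sin_add_β_ne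
  rw [← mul_div_mul_left _ _ (norm_ne_zero_iff.2 hN.c_ne_zero), h.1, h.2,
    mul_div_mul_left _ _ (neg_ne_zero.2 hN.sin_add_β_ne)]

lemma ρL_eq_arctan {x : ℂ} (hx : normSq x ≤ 1) : N.ρL (N.point N.c) (N.point x) =
    Real.arctan ((conj (-N.c) * (x - N.c)).im / (conj (-N.c) * (x - N.c)).re) := by
  rw [ρL_point hN.BL_ne, arg_eq_arctan (hN.re_pos hx)]

/-- Two points of the arc seen from `C` in the same direction coincide. -/
lemma eq_of_slope_eq {σ τ : ℝ} (hσ : σ ∈ Icc 0 N.γ) (hτ : τ ∈ Icc 0 N.γ)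
    (h : (conj (-N.c) * (exp (σ * I) - N.c)).im / (conj (-N.c) * (exp (σ * I) - N.c)).re =
      (conj (-N.c) * (exp (τ * I) - N.c)).im / (conj (-N.c) * (exp (τ * I) - N.c)).re) :
    exp (τ * I) = exp (σ * I) := by
  obtain ⟨s, hs, e⟩ := exists_pos_eq_mul (hN.re_pos (normSq_exp_ofReal_mul_I _).le)
    (hN.re_pos (normSq_exp_ofReal_mul_I _).le) h
  refine hN.eq_of_sub_eq_mul hσ hτ hs ?_
  have hc : conj (-N.c) ≠ 0 := by simpa using hN.c_ne_zero
  apply mul_left_cancel₀ hc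
  rw [e]; ring

/-- Two points of the arc other than `B_L` that are seen from `C` under the same angle with `B_L`
coincide. -/
lemma eq_of_cot_eq {σ τ : ℝ} (hσ : σ ∈ Ioc 0 N.γ) (hτ : τ ∈ Ioc 0 N.γ)
    (h : (conj (1 - N.c) * (exp (σ * I) - N.c)).re / (conj (1 - N.c) * (exp (σ * I) - N.c)).im =
      (conj (1 - N.c) * (exp (τ * I) - N.c)).re / (conj (1 - N.c) * (exp (τ * I) - N.c)).im) :
    exp (τ * I) = exp (σ * I) := by
  -- Multiplication by `I` moves the lower half-plane to the right one and turns cotangents into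
  -- negated slopes.
  obtain ⟨s, hs, e⟩ := exists_pos_eq_mul (z := I * (conj (1 - N.c) * (exp (σ * I) - N.c)))
    (w := I * (conj (1 - N.c) * (exp (τ * I) - N.c)))
    (by rw [I_mul_re]; exact neg_pos.2 (hN.im_neg hσ))
    (by rw [I_mul_re]; exact neg_pos.2 (hN.im_neg hτ))
    (by rw [I_mul_re, I_mul_re, I_mul_im, I_mul_im, div_neg, div_neg, h])
  refine hN.eq_of_sub_eq_mul (Ioc_subset_Icc_self hσ) (Ioc_subset_Icc_self hτ) hs ?_
  have hc : conj (1 - N.c) ≠ 0 := by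
    intro h0
    have := hN.im_neg hσ
    rw [h0] at this
    simp at this
  apply mul_left_cancel₀ hc
  apply mul_left_cancel₀ I_ne_zero
  rw [e]; ring

lemma angle_eq {τ : ℝ} (hτ : τ ∈ Ioc 0 N.γ) :
    EuclideanGeometry.angle N.BL (N.point N.c) (N.point (exp (τ * I))) =
      -arg (conj (1 - N.c) * (exp (τ * I) - N.c)) := by
  have h1 : (1 : ℂ) ≠ N.c := by
    intro h
    have := hN.im_neg hτ
    rw [← h] at this
    simp at this
  rw [← point_one, angle_point hN.BL_ne h1 (sub_ne_zero.1 (hN.exp_sub_c_ne τ)),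
    abs_of_neg (arg_neg_iff.2 (hN.im_neg hτ))]

lemma cot_angle {τ : ℝ} (hτ : τ ∈ Ioc 0 N.γ) :
    Real.cot (EuclideanGeometry.angle N.BL (N.point N.c) (N.point (exp (τ * I)))) =
      -((conj (1 - N.c) * (exp (τ * I) - N.c)).re / (conj (1 - N.c) * (exp (τ * I) - N.c)).im) := by
  rw [hN.angle_eq hτ, Real.cot_eq_cos_div_sin, Real.cos_neg, Real.sin_neg, div_neg, ← inv_inj,
    inv_neg, inv_neg, inv_div, inv_div, ← Real.tan_eq_sin_div_cos, tan_arg]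

/-- The triangle `C B_L B'` has angle `π - (βL - δL)` at `B_L`, and the product of the sine
quotients is the side ratio `|B_L C| / |B_L B'|`, the two signed distances having opposite signs. -/
lemma cotBCD_eq : N.cotBCD =
    -((conj (1 - N.c) * (N.b - N.c)).re / (conj (1 - N.c) * (N.b - N.c)).im) := by
  have hs : Real.sin (N.βL - N.δL) ≠ 0 := (Real.sin_pos_of_pos_of_lt_pi
    (by linarith [hN.δL_lt]) (by linarith [hN.βL_mem.2, hN.δL_nonneg])).ne'
  have h1 := hN.sin_half_add_βR_pos.ne'
  have h2 := (Real.sin_pos_of_mem_Ioo hN.half_γ_mem).ne'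
  have h3 := hN.sin_add_δ_pos.ne'
  have h4 := hN.sin_α_pos.ne'
  have hT := hN.coeff_δ_pos.ne'
  have hT' := hN.coeff_β_neg.ne
  have hquot : Real.sin N.α / Real.sin (N.βR + N.γ / 2) *
      (Real.sin (N.γ / 2 + N.δR) / Real.sin (N.γ + N.δL + N.δR)) =
      -(perpCoeff N.γ N.δL N.δR / perpCoeff N.γ N.βL N.βR) := by
    rw [perpCoeff, perpCoeff, cos_sub_cos_add, cos_sub_cos_add, sin_add_β, add_comm N.βR]
    field_simp
  have e1 : (conj (1 - N.c) * (N.b - N.c)).re = perpCoeff N.γ N.δL N.δR *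
      (perpCoeff N.γ N.δL N.δR - perpCoeff N.γ N.βL N.βR * Real.cos (N.βL - N.δL)) := by
    simp only [c, b, perpFoot, mul_re, conj_re, conj_im, sub_re, sub_im, one_re, one_im,
      Real.cos_sub]
    linear_combination (perpCoeff N.γ N.δL N.δR) ^ 2 * Real.sin_sq_add_cos_sq N.δL
  have e2 : (conj (1 - N.c) * (N.b - N.c)).im = perpCoeff N.γ N.δL N.δR *
      (perpCoeff N.γ N.βL N.βR * Real.sin (N.βL - N.δL)) := by
    simp only [c, b, perpFoot, mul_im, conj_re, conj_im, sub_re, sub_im, one_re, one_im,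
      Real.sin_sub]
    ring
  rw [cotBCD, hquot, e1, e2]
  field_simp
  ring

/-- In the triangle `A C X`, `ψ_L + ρ_L` is the exterior angle at `X`, whose sine is `r sin ρ_L` by
the law of sines. Visibility keeps it in `[-π/2, π/2]`, the range of `arcsin`. -/
lemma ψL_eq {τ : ℝ} (hτ : τ ∈ Icc 0 N.γ) :
    N.ψL (N.point N.c) (N.point (exp (τ * I))) =
      Real.arcsin (N.r (N.point N.c) *
        Real.sin (N.ρL (N.point N.c) (N.point (exp (τ * I))))) -
      N.ρL (N.point N.c) (N.point (exp (τ * I))) := by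
  have hn := normSq_exp_ofReal_mul_I τ
  have hre := hN.re_pos hn.le
  have hone := hN.one_le_re hτ
  rw [r_point hN.BL_ne, ρL_point hN.BL_ne, ψL_point hN.BL_ne, sin_arg]
  set x := exp (τ * I) with hx
  set z := conj (-N.c) * (x - N.c) with hz
  set w := conj x * N.c with hw
  have hwre : 1 ≤ w.re := by
    have : w.re = (conj N.c * x).re := by simp [hw, mul_re, mul_comm]
    rw [this]; exact hone
  have hc : ‖N.c‖ ≠ 0 := norm_ne_zero_iff.2 hN.c_ne_zero
  have hw0 : w ≠ 0 := by intro h0; rw [h0] at hwre; norm_num at hwre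
  have hz0 : z ≠ 0 := by intro h0; rw [h0] at hre; simp at hre
  have hxx : conj x * x = 1 := by rw [← normSq_eq_conj_mul_self, hn]; simp
  have hnx : ‖x‖ = 1 := norm_exp_ofReal_mul_I τ
  have hprod : w * z = (normSq N.c : ℂ) * (w - 1) := by
    rw [normSq_eq_conj_mul_self, hz, hw, map_neg]
    linear_combination (-N.c * conj N.c) * hxx
  have hsum : arg w + arg z = arg (w - 1) := by
    rw [← arg_real_mul (w - 1) (normSq_pos.2 hN.c_ne_zero), ← hprod, arg_mul hw0 hz0]
    have a1 := abs_lt.1 (abs_arg_lt_pi_div_two_iff.2 (Or.inl (show 0 < w.re by linarith)))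
    have a2 := abs_lt.1 (abs_arg_lt_pi_div_two_iff.2 (Or.inl hre))
    constructor <;> linarith [a1.1, a1.2, a2.1, a2.2]
  have harg : arg (w - 1) = Real.arcsin (‖N.c‖ * (z.im / ‖z‖)) := by
    rw [arg_of_re_nonneg (by simpa using hwre)]
    have hzn : ‖z‖ = ‖N.c‖ * ‖w - 1‖ := by
      have : w - 1 = conj x * (N.c - x) := by rw [hw, mul_sub, hxx]
      rw [this, hz, norm_mul, norm_mul, norm_conj, norm_conj, norm_neg, hnx, one_mul,
        norm_sub_rev]
    have hzi : z.im = (w - 1).im := by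
      simp only [hz, hw, mul_im, conj_re, conj_im, sub_re, sub_im, neg_re, neg_im, one_im]; ring
    rw [hzn, hzi]
    congr 1
    field_simp
  rw [← harg, ← hsum]; ring

lemma ρL_eq {τ : ℝ} (hτ : τ ∈ Ioc 0 N.γ) :
    N.ρL (N.point N.c) (N.point (exp (τ * I))) = Real.pi / 2 - (N.γL (N.point N.c) + N.δL +
      EuclideanGeometry.angle N.BL (N.point N.c) (N.point (exp (τ * I)))) := by
  have hre := hN.re_pos (normSq_exp_ofReal_mul_I τ).le
  have him := hN.im_neg hτ
  have hc := hN.c_ne_zero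
  have hxc := hN.exp_sub_c_ne τ
  have hT := hN.coeff_δ_pos
  rw [hN.angle_eq hτ, ρL_point hN.BL_ne, γL_point hN.BL_ne]
  set x := exp (τ * I) with hx
  set z := conj (-N.c) * (x - N.c) with hz
  set m := conj (1 - N.c) * (x - N.c) with hm
  have hz0 : z ≠ 0 := by intro h0; rw [h0] at hre; simp at hre
  have hm0 : m ≠ 0 := by intro h0; rw [h0] at him; simp at him
  have hk : 0 < normSq N.c * normSq (x - N.c) * perpCoeff N.γ N.δL N.δR :=
    mul_pos (mul_pos (normSq_pos.2 hc) (normSq_pos.2 hxc)) hT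
  have hprod : z * N.c * conj m = ((normSq N.c * normSq (x - N.c) * perpCoeff N.γ N.δL N.δR : ℝ) : ℂ)
      * exp ((Real.pi / 2 - N.δL : ℝ) * I) := by
    have e : N.c - 1 = (perpCoeff N.γ N.δL N.δR : ℂ) * exp ((Real.pi / 2 - N.δL : ℝ) * I) := by
      apply Complex.ext
      · rw [re_ofReal_mul, exp_ofReal_mul_I_re, Real.cos_pi_div_two_sub]; simp [c, perpFoot]
      · rw [im_ofReal_mul, exp_ofReal_mul_I_im, Real.sin_pi_div_two_sub]; simp [c, perpFoot]
    push_cast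
    push_cast at e
    rw [mul_assoc _ (perpCoeff N.γ N.δL N.δR : ℂ), ← e, normSq_eq_conj_mul_self,
      normSq_eq_conj_mul_self, hz, hm]
    simp only [map_mul, map_sub, map_neg, map_one, conj_conj]
    ring
  -- The claim modulo `2π`, read off the argument of the product in `hprod`; the bounds below
  -- exclude a nonzero multiple.
  have hangle : ((arg z + arg N.c - arg m : ℝ) : Real.Angle) = ((Real.pi / 2 - N.δL : ℝ) : Real.Angle) := by
    rw [Real.Angle.coe_sub, Real.Angle.coe_add, ← arg_mul_coe_angle hz0 hc, sub_eq_add_neg,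
      ← arg_conj_coe_angle, ← arg_mul_coe_angle (mul_ne_zero hz0 hc) (by simpa using hm0), hprod,
      arg_real_mul _ hk]
    rw [arg_exp_mul_I, Real.Angle.coe_toIocMod]
  obtain ⟨n, hn⟩ := Real.Angle.angle_eq_iff_two_pi_dvd_sub.1 hangle
  have a1 := abs_lt.1 (abs_arg_lt_pi_div_two_iff.2 (Or.inl hre))
  have a2 : arg m < 0 := arg_neg_iff.2 him
  have a3 := neg_pi_lt_arg m
  have hcre : 0 < N.c.re := by
    simp only [c, perpFoot]
    linarith [mul_nonneg hT.le hN.sin_δL_nonneg]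
  have a4 := abs_lt.1 (abs_arg_lt_pi_div_two_iff.2 (Or.inl hcre))
  have hδ := hN.δL_nonneg
  have hδ' := hN.δL_lt.trans hN.βL_mem.2
  -- The imaginary part of `c` has the sign of `cos δL`, so `arg c` and `π/2 - δL` lie on the same
  -- side of `0`. The cruder bound `π` would not exclude `n = 1`.
  have a5 : -(Real.pi / 2) ≤ arg N.c - (Real.pi / 2 - N.δL) ∧
      arg N.c - (Real.pi / 2 - N.δL) ≤ Real.pi / 2 := by
    rcases le_total N.δL (Real.pi / 2) with h | h
    · have : 0 ≤ arg N.c := by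
        rw [arg_nonneg_iff]
        exact mul_nonneg hT.le (Real.cos_nonneg_of_mem_Icc ⟨by linarith, h⟩)
      constructor <;> linarith
    · have : arg N.c ≤ 0 := by
        by_contra h'
        push Not at h'
        have h2 := Real.sin_pos_of_pos_of_lt_pi h' (by linarith [Real.pi_pos])
        rw [sin_arg] at h2
        have h3 : N.c.im ≤ 0 := mul_nonpos_of_nonneg_of_nonpos hT.le
          (Real.cos_nonpos_of_pi_div_two_le_of_le h (by linarith))
        exact absurd (div_nonpos_of_nonpos_of_nonneg h3 (norm_nonneg _)) (not_le.2 h2)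
      constructor <;> linarith
  have hn0 : n = 0 := by
    have hpi := Real.pi_pos
    have l1 : (-1 : ℝ) < n := by
      by_contra h
      push Not at h
      nlinarith [a1.1, a5.1]
    have l2 : (n : ℝ) < 1 := by
      by_contra h
      push Not at h
      nlinarith [a1.2, a5.2]
    have l1' : -1 < n := by exact_mod_cast l1
    have l2' : n < 1 := by exact_mod_cast l2
    omega
  rw [hn0] at hn
  simp at hn
  linarith

end Admissible

end Development

end Origon

end

theorem theorem3p7 (N : Origon.Development) (hN : N.Admissible) :
    ∃ C B' D : ℂ,
      -- the perpendiculars to `ℓ_L`, `ℓ_R` meet exactly in `C`, those to `k_L`, `k_R` in `B'`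
      Origon.Development.perpLine N.BL N.ellDirL ∩
        Origon.Development.perpLine N.BR N.ellDirR = {C} ∧
      Origon.Development.perpLine N.BL N.kDirL ∩
        Origon.Development.perpLine N.BR N.kDirR = {B'} ∧
      -- the geometric dividing point exists, is unique, and is not an end point of the arc
      segment ℝ B' C ∩ N.minorArc = {D} ∧
      D ∈ N.openMinorArc ∧
      -- it is the numerical dividing point, given by the solution of the extrusion equation
      N.V₁ C - N.r C * N.V₂ ≠ 0 ∧
      {X ∈ N.minorArc | (N.V₁ C - N.r C * N.V₂) * Real.tan (N.ρL C X) = N.W C} = {D} ∧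
      {X ∈ N.minorArc | N.ρL C X = Real.arctan (N.W C / (N.V₁ C - N.r C * N.V₂))} = {D} ∧
      N.ψL C D = Real.arcsin (N.r C * Real.sin (N.ρL C D)) - N.ρL C D ∧
      -- and it is the point given by the closed formula for the angle `B_L C D`
      {X ∈ N.openMinorArc | Real.cot (EuclideanGeometry.angle N.BL C X) = N.cotBCD} = {D} ∧
      N.ρL C D = Real.pi / 2 - (N.γL C + N.δL + EuclideanGeometry.angle N.BL C D) := by
  open Origon.Development in
  obtain ⟨τ, hτ, s, hs, hD⟩ := hN.exists_mem_arc
  have hτ1 := Ioo_subset_Icc_self hτ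
  have hτ2 := Ioo_subset_Ioc_self hτ
  have hmem (σ : ℝ) (hσ : σ ∈ Icc 0 N.γ) : N.point (Complex.exp (σ * Complex.I)) ∈ N.minorArc := by
    rw [minorArc_eq]; exact ⟨σ, hσ, rfl⟩
  have hopen (σ : ℝ) (hσ : σ ∈ Icc 0 N.γ) :
      N.point (Complex.exp (σ * Complex.I)) ∈ N.openMinorArc ↔ σ ∈ Ioo 0 N.γ := by
    have hγ := hN.γ_mem
    have hinj {t : ℝ} (ht : t ∈ Icc 0 N.γ)
        (e : Complex.exp (σ * Complex.I) = Complex.exp (t * Complex.I)) : σ = t := by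
      have e' := congrArg Complex.re e
      rw [Complex.exp_ofReal_mul_I_re, Complex.exp_ofReal_mul_I_re] at e'
      exact Real.injOn_cos ⟨hσ.1, by linarith [hσ.2, hγ.2]⟩ ⟨ht.1, by linarith [ht.2, hγ.2]⟩ e'
    have h0 : N.point (Complex.exp (σ * Complex.I)) = N.BL ↔ σ = 0 := by
      rw [← point_one, (point_injective hN.BL_ne).eq_iff]
      refine ⟨fun e => hinj ⟨le_rfl, hγ.1.le⟩ (by simpa using e), ?_⟩
      rintro rfl; simp
    have h1 : N.point (Complex.exp (σ * Complex.I)) = N.BR ↔ σ = N.γ := by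
      rw [← point_exp_γ, (point_injective hN.BL_ne).eq_iff]
      refine ⟨fun e => hinj ⟨hγ.1.le, le_rfl⟩ e, ?_⟩
      rintro rfl; rfl
    rw [openMinorArc, mem_sdiff, mem_insert_iff, mem_singleton_iff, h0, h1, not_or]
    constructor
    · rintro ⟨-, a, b⟩
      exact ⟨lt_of_le_of_ne hσ.1 (Ne.symm a), lt_of_le_of_ne hσ.2 b⟩
    · rintro ⟨a, b⟩
      exact ⟨hmem σ hσ, a.ne', b.ne⟩
  -- `D - C` is a positive multiple of `B' - C`, so the factor cancels.
  have hslope : (starRingEnd ℂ (-N.c) * (Complex.exp (τ * Complex.I) - N.c)).im /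
      (starRingEnd ℂ (-N.c) * (Complex.exp (τ * Complex.I) - N.c)).re =
      N.W (N.point N.c) / (N.V₁ (N.point N.c) - N.r (N.point N.c) * N.V₂) := by
    rw [hN.W_div, hD, mul_left_comm, Complex.im_ofReal_mul, Complex.re_ofReal_mul,
      mul_div_mul_left _ _ hs.1.ne']
  have hcot : Real.cot (EuclideanGeometry.angle N.BL (N.point N.c)
      (N.point (Complex.exp (τ * Complex.I)))) = N.cotBCD := by
    rw [hN.cot_angle hτ2, hN.cotBCD_eq, hD, mul_left_comm, Complex.im_ofReal_mul,
      Complex.re_ofReal_mul, mul_div_mul_left _ _ hs.1.ne']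
  have hset : {X ∈ N.minorArc | N.ρL (N.point N.c) X = Real.arctan (N.W (N.point N.c) /
      (N.V₁ (N.point N.c) - N.r (N.point N.c) * N.V₂))} =
      {N.point (Complex.exp (τ * Complex.I))} := by
    apply Subset.antisymm
    · rintro X ⟨hX, hX'⟩
      rw [minorArc_eq] at hX
      obtain ⟨σ, hσ, rfl⟩ := hX
      simp only at hX'
      rw [hN.ρL_eq_arctan (Origon.normSq_exp_ofReal_mul_I σ).le, ← hslope] at hX'
      exact congrArg N.point (hN.eq_of_slope_eq hτ1 hσ (Real.arctan_injective hX').symm)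
    · rintro X rfl
      refine ⟨hmem τ hτ1, ?_⟩
      rw [hN.ρL_eq_arctan (Origon.normSq_exp_ofReal_mul_I τ).le, hslope]
  refine ⟨N.point N.c, N.point N.b, N.point (Complex.exp (τ * Complex.I)),
    perpLine_inter_perpLine hN.BL_ne hN.sin_add_δ_pos.ne',
    perpLine_inter_perpLine hN.BL_ne hN.sin_add_β_ne, ?_, (hopen τ hτ1).2 hτ,
    hN.V₁_sub_pos.ne', ?_, hset, hN.ψL_eq hτ1, ?_, hN.ρL_eq hτ2⟩
  · have hseg (x : ℂ) : N.point x ∈ segment ℝ (N.point N.b) (N.point N.c) ↔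
        ∃ t ∈ Icc (0 : ℝ) 1, x - N.c = t * (N.b - N.c) := by
      rw [segment_symm, segment_eq_image']
      refine exists_congr fun t => and_congr_right fun _ => ?_
      simp only
      rw [point_sub, Complex.real_smul, show N.point N.c + t * ((N.BL - N.A) * (N.b - N.c)) =
        N.point (N.c + t * (N.b - N.c)) by simp only [point]; ring,
        (point_injective hN.BL_ne).eq_iff, sub_eq_iff_eq_add', eq_comm]
    apply Subset.antisymm
    · rintro X ⟨hX, hX'⟩
      rw [minorArc_eq] at hX'
      obtain ⟨σ, hσ, rfl⟩ := hX'
      obtain ⟨t, ht, e⟩ := (hseg _).1 hX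
      have ht0 : 0 < t := by
        refine lt_of_le_of_ne ht.1 ?_
        rintro rfl
        apply hN.exp_sub_c_ne σ
        rw [e]; simp
      have hs0 : (s : ℂ) ≠ 0 := by exact_mod_cast hs.1.ne'
      refine congrArg N.point (hN.eq_of_sub_eq_mul hτ1 hσ (div_pos ht0 hs.1) ?_)
      rw [e, hD]
      push_cast
      field_simp
    · rintro X rfl
      exact ⟨(hseg _).2 ⟨s, Ioo_subset_Icc_self hs, hD⟩, hmem τ hτ1⟩
  · rw [← hset]
    ext X
    refine and_congr_right fun hX => ?_
    rw [minorArc_eq] at hX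
    obtain ⟨σ, hσ, rfl⟩ := hX
    simp only
    -- On the arc `ρ_L` is itself an arctangent, so the tangent and arctangent equations are
    -- equivalent.
    rw [hN.ρL_eq_arctan (Origon.normSq_exp_ofReal_mul_I σ).le, Real.tan_arctan,
      Real.arctan_injective.eq_iff, eq_div_iff hN.V₁_sub_pos.ne', mul_comm]
  · apply Subset.antisymm
    · rintro X ⟨hX, hX'⟩
      have hX2 := hX.1
      rw [minorArc_eq] at hX2
      obtain ⟨σ, hσ, rfl⟩ := hX2
      have hσ2 := Ioo_subset_Ioc_self ((hopen σ hσ).1 hX)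
      simp only at hX'
      rw [← hcot, hN.cot_angle hσ2, hN.cot_angle hτ2, neg_inj] at hX'
      exact congrArg N.point (hN.eq_of_cot_eq hτ2 hσ2 hX'.symm)
    · rintro X rfl
      exact ⟨(hopen τ hτ1).2 hτ, hcot⟩
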